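/- Let $m\ge 1$ and let $\Delta=\{\delta_1,\dots,\delta_m\}$ denote commuting derivations. Let $U$ be a $\Delta$-closed field (a model of $\mathrm{DCF}_{0,m}$, i.e. a $\Delta$-field of characteristic $0$ in which every finite system of $\Delta$-polynomial equations and inequations over $U$ that is solvable in some $\Delta$-field extension of $U$ is solvable), and let $F\subseteq U$ be a $\Delta$-subfield. Points have coordinates in $U$. A subset of $\mathbb A^n$ is $\Delta$-closed if it is the zero set of a collection of $\Delta$-polynomials over $F$. A $\Delta$-polynomial $f$ is $\Delta$-homogeneous of degree $e$ in $\bar y$ if $f(t\bar y)=t^e f(\bar y)$ for $t$ $\Delta$-transcendental over $F\{\bar y\}$ (with any remaining variables kept fixed). The $\Delta$-closed subsets of $\mathbb P^n$, $\mathbb P^n\times\mathbb A^k$, $\mathbb P^n\times\mathbb P^k$ are the zero sets of collections of $\Delta$-polynomials over $F$ that are $\Delta$-homogeneous in each group of projective coordinates. A quasi-projective $\Delta$-variety is a relatively open subset of a $\Delta$-closed subset of some $\mathbb P^k$. A $\Delta$-closed $X\subseteq\mathbb P^n$ is $\Delta$-complete if for every quasi-projective $\Delta$-variety $Y$ the projection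 $\pi_2:X\times Y\to Y$ maps $\Delta$-closed sets to $\Delta$-closed sets. An element $b\in U$ is $\Delta$-transcendental over $F$ if $f(b)\ne 0$ for every nonzero $f\in F\{z\}$. **Proposition.** For every $n\ge 1$, projective space $\mathbb P^n$ is not $\Delta$-complete. Moreover, for each $\delta\in\Delta$, let $Z\subseteq\mathbb P^1\times\mathbb A^1$ be the set of all $([y:1],z)$ with $y,z\in U$ and $$z(\delta y)^2+y^4-1=0,\qquad 2z\,\delta^2y+\delta z\,\delta y+4y^3=0 .$$ Then: 1. $Z$ is $\Delta$-closed in $\mathbb P^1\times\mathbb A^1$. 2. $\pi_2(Z)$ contains every $b\in U$ that is $\Delta$-transcendental over $F$. Such $b$ exist whenever $U$ is saturated over $F$, i.e. whenever every system of $\Delta$-polynomial equations and inequations over $F$ in finitely many variables, each finite part of which is solvable in $U$, is solvable in $U$. 3. $0\notin\pi_2(Z)$. 4. $\pi_2(Z)$ is not $\Delta$-closed in $\mathbb A^1$. -/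

import Mathlib

open scoped LinearAlgebra.Projectivization

universe u v w

/-- A `Δ`-ring: a commutative ring with a family of pairwise commuting derivations, indexed by
`ι` (so `Δ = {d j | j : ι}`). A `Δ`-field is a field with this structure. -/
class DeltaRing (ι : Type w) (R : Type u) [CommRing R] where
  d : ι → R →+ R
  d_mul : ∀ (j : ι) (x y : R), d j (x * y) = x * d j y + d j x * y
  d_comm : ∀ (i j : ι) (x : R), d i (d j x) = d j (d i x)

/-- `A` is a `Δ`-algebra over `R`: the derivations of `A` extend those of `R`. -/
class DeltaAlgebra (ι : Type w) (R : Type u) (A : Type v) [CommRing R] [CommRing A]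
    [DeltaRing ι R] [DeltaRing ι A] [Algebra R A] : Prop where
  d_algebraMap : ∀ (j : ι) (x : R),
    DeltaRing.d j (algebraMap R A x) = algebraMap R A (DeltaRing.d j x)

/-- The derivative `θ x`, for a derivative operator `θ` in the free commutative monoid on `Δ`,
written as a multiset of derivations: `{i, j, ...} x = d i (d j (... x))`. -/
def deltaOp {ι : Type w} {R : Type u} [CommRing R] [DeltaRing ι R] (θ : Multiset ι) (x : R) : R :=
  haveI : LeftCommutative (fun (j : ι) (y : R) => DeltaRing.d j y) := ⟨DeltaRing.d_comm⟩
  θ.foldr (fun (j : ι) (y : R) => DeltaRing.d j y) x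

/-- The ring `R{y_s : s ∈ σ}` of `Δ`-polynomials: the polynomial ring over `R` in the variables
`θ y_s`, for `s ∈ σ` and `θ` a derivative operator. -/
abbrev DeltaPoly (ι : Type w) (σ : Type v) (R : Type u) [CommRing R] :=
  MvPolynomial (σ × Multiset ι) R

namespace DeltaPoly

variable {ι : Type w} {σ : Type v} {R : Type u} [CommRing R] [DeltaRing ι R]

/-- The additive map that applies the derivation `d j` of `R` to every coefficient. -/
noncomputable def coeffMap (j : ι) : DeltaPoly ι σ R →+ DeltaPoly ι σ R where
  toFun f := AddMonoidAlgebra.map (DeltaRing.d j) f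
  map_zero' := AddMonoidAlgebra.map_zero _
  map_add' f g := AddMonoidAlgebra.map_add _ f g

theorem coeffMap_monomial (j : ι) (s : (σ × Multiset ι) →₀ ℕ) (a : R) :
    coeffMap j (MvPolynomial.monomial s a) = MvPolynomial.monomial s (DeltaRing.d j a) :=
  AddMonoidAlgebra.map_single _ _ _

theorem coeffMap_mul (j : ι) (f g : DeltaPoly ι σ R) :
    coeffMap j (f * g) = f * coeffMap j g + coeffMap j f * g := by
  induction f using MvPolynomial.induction_on' with
  | add p q hp hq => simp only [add_mul, map_add, hp, hq]; ring
  | monomial s a =>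
    induction g using MvPolynomial.induction_on' with
    | add p q hp hq => simp only [mul_add, map_add, hp, hq]; ring
    | monomial t b =>
      simp only [coeffMap_monomial, MvPolynomial.monomial_mul, DeltaRing.d_mul, map_add]

/-- The derivation `d j` of `R{y}`: it extends that of `R` and maps `θ y_s` to `(d j · θ) y_s`. -/
noncomputable def der (j : ι) : DeltaPoly ι σ R →+ DeltaPoly ι σ R :=
  coeffMap j +
    (MvPolynomial.mkDerivation R (fun p : σ × Multiset ι =>
      (MvPolynomial.X (p.1, j ::ₘ p.2) : DeltaPoly ι σ R))).toLinearMap.toAddMonoidHom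

theorem der_mul (j : ι) (f g : DeltaPoly ι σ R) : der j (f * g) = f * der j g + der j f * g := by
  simp only [der, AddMonoidHom.add_apply, coeffMap_mul, LinearMap.toAddMonoidHom_coe,
    Derivation.coeFn_coe, Derivation.leibniz, smul_eq_mul]
  ring

theorem der_X (j : ι) (s : σ) (θ : Multiset ι) :
    der j (MvPolynomial.X (s, θ) : DeltaPoly ι σ R) = MvPolynomial.X (s, j ::ₘ θ) := by
  have h1 : DeltaRing.d j (1 : R) = 0 := by simpa using DeltaRing.d_mul j (1 : R) 1
  have h : coeffMap j (MvPolynomial.X (s, θ) : DeltaPoly ι σ R) = 0 := by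
    rw [MvPolynomial.X, coeffMap_monomial, h1, map_zero]
  simp [der, h, MvPolynomial.mkDerivation_X]

theorem der_C (j : ι) (a : R) :
    der j (MvPolynomial.C a : DeltaPoly ι σ R) = MvPolynomial.C (DeltaRing.d j a) := by
  have h : coeffMap j (MvPolynomial.C a : DeltaPoly ι σ R) = MvPolynomial.C (DeltaRing.d j a) :=
    coeffMap_monomial j 0 a
  simp [der, h]

noncomputable instance : DeltaRing ι (DeltaPoly ι σ R) where
  d := der
  d_mul := der_mul
  d_comm i j f := by
    induction f using MvPolynomial.induction_on with
    | C a => simp only [der_C, DeltaRing.d_comm i j a]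
    | add p q hp hq => simp only [map_add, hp, hq]
    | mul_X p s hp =>
      obtain ⟨s, θ⟩ := s
      simp only [der_mul, map_add, hp, der_X, Multiset.cons_swap i j]
      ring

instance : DeltaAlgebra ι R (DeltaPoly ι σ R) where
  d_algebraMap j x := der_C j x

/-- The value `f(a)` of a `Δ`-polynomial `f` over `R` at a tuple `a` of elements of a
`Δ`-algebra `A` over `R`: the variable `θ y_s` takes the value `θ (a s)`. -/
noncomputable def eval {A : Type*} [CommRing A] [DeltaRing ι A] [Algebra R A] (a : σ → A)
    (f : DeltaPoly ι σ R) : A :=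
  MvPolynomial.aeval (fun p : σ × Multiset ι => deltaOp p.2 (a p.1)) f

open Classical in
/-- `f` is `Δ`-homogeneous of degree `e` in the variables `y_s`, `s ∈ S`: over the ring
`R{y, t}` of `Δ`-polynomials in the variables of `f` and one more variable `t` (which is
`Δ`-transcendental over `R{y}`), replacing `y_s` by `t y_s` for all `s ∈ S`, and keeping the other
variables, multiplies `f` by `t ^ e`. -/
def IsHomogeneousIn (S : Set σ) (f : DeltaPoly ι σ R) (e : ℕ) : Prop :=
  let Y : σ → DeltaPoly ι (Option σ) R := fun s => MvPolynomial.X (some s, 0)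
  let T : DeltaPoly ι (Option σ) R := MvPolynomial.X (none, 0)
  eval (fun s => if s ∈ S then T * Y s else Y s) f = T ^ e * eval Y f

end DeltaPoly

section Closed

/-! Points have coordinates in `U`; equations have coefficients in the `Δ`-subfield `F`. -/

variable (ι : Type w) (F : Type u) {U : Type v} [Field F] [Field U] [DeltaRing ι F]
  [DeltaRing ι U] [Algebra F U] {n k : ℕ}

/-- `Δ`-closed subsets of affine space `A^n`. -/
def IsDeltaClosedAffine (X : Set (Fin n → U)) : Prop :=
  ∃ E : Set (DeltaPoly ι (Fin n) F), X = {a | ∀ f ∈ E, f.eval a = 0}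

/-- `Δ`-closed subsets of projective space `P^n`: zero sets of collections of `Δ`-homogeneous
`Δ`-polynomials. By homogeneity it does not matter which homogeneous coordinates `p.rep` are used
for `p`. -/
def IsDeltaClosedProj (X : Set (ℙ U (Fin (n + 1) → U))) : Prop :=
  ∃ E : Set (DeltaPoly ι (Fin (n + 1)) F), (∀ f ∈ E, ∃ e, f.IsHomogeneousIn Set.univ e) ∧
    X = {p | ∀ f ∈ E, f.eval p.rep = 0}

/-- `Δ`-closed subsets of `P^n × A^k`: zero sets of collections of `Δ`-polynomials in
`y_0, …, y_n, z_1, …, z_k` that are `Δ`-homogeneous in `y`. -/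
def IsDeltaClosedProjAffine (X : Set (ℙ U (Fin (n + 1) → U) × (Fin k → U))) : Prop :=
  ∃ E : Set (DeltaPoly ι (Fin (n + 1) ⊕ Fin k) F),
    (∀ f ∈ E, ∃ e, f.IsHomogeneousIn (Set.range Sum.inl) e) ∧
    X = {p | ∀ f ∈ E, f.eval (Sum.elim p.1.rep p.2) = 0}

/-- `Δ`-closed subsets of `P^n × P^k`: zero sets of collections of `Δ`-polynomials in
`y_0, …, y_n, z_0, …, z_k` that are `Δ`-homogeneous in `y` and in `z`. -/
def IsDeltaClosedProjProj
    (X : Set (ℙ U (Fin (n + 1) → U) × ℙ U (Fin (k + 1) → U))) : Prop :=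
  ∃ E : Set (DeltaPoly ι (Fin (n + 1) ⊕ Fin (k + 1)) F),
    (∀ f ∈ E, (∃ e, f.IsHomogeneousIn (Set.range Sum.inl) e) ∧
      ∃ e, f.IsHomogeneousIn (Set.range Sum.inr) e) ∧
    X = {p | ∀ f ∈ E, f.eval (Sum.elim p.1.rep p.2.rep) = 0}

/-- Quasi-projective `Δ`-varieties: the relatively open subsets of `Δ`-closed subsets of `P^k`. -/
def IsQuasiProjective (Y : Set (ℙ U (Fin (k + 1) → U))) : Prop :=
  ∃ A B : Set (ℙ U (Fin (k + 1) → U)),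
    IsDeltaClosedProj ι F A ∧ IsDeltaClosedProj ι F B ∧ Y = A \ B

/-- A (`Δ`-closed) subset `X` of `P^n` is `Δ`-complete if for every quasi-projective `Y`, the
projection `X × Y → Y` maps relatively `Δ`-closed subsets of `X × Y` to relatively `Δ`-closed
subsets of `Y`. -/
def IsDeltaComplete (X : Set (ℙ U (Fin (n + 1) → U))) : Prop :=
  ∀ (k : ℕ) (Y : Set (ℙ U (Fin (k + 1) → U))), IsQuasiProjective ι F Y →
    ∀ Z : Set (ℙ U (Fin (n + 1) → U) × ℙ U (Fin (k + 1) → U)), IsDeltaClosedProjProj ι F Z →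
      ∃ C : Set (ℙ U (Fin (k + 1) → U)), IsDeltaClosedProj ι F C ∧
        Prod.snd '' (Z ∩ X ×ˢ Y) = C ∩ Y

/-- `b` is `Δ`-transcendental over `F`: it is not a zero of a nonzero `Δ`-polynomial over `F`. -/
def IsDeltaTranscendental (b : U) : Prop :=
  ∀ f : DeltaPoly ι (Fin 1) F, f ≠ 0 → f.eval ![b] ≠ 0

variable (U) in
/-- `U` realizes all types over `F` in finitely many variables: if every finite part of a system
of `Δ`-polynomial equations and inequations over `F` has a solution in `U`, then so does the whole
system. (By quantifier elimination, quantifier-free types suffice when `U` is `Δ`-closed.) -/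
def IsSaturatedOver : Prop :=
  ∀ (r : ℕ) (E N : Set (DeltaPoly ι (Fin r) F)),
    (∀ E₀ N₀ : Finset (DeltaPoly ι (Fin r) F), ↑E₀ ⊆ E → ↑N₀ ⊆ N →
      ∃ a : Fin r → U, (∀ f ∈ E₀, f.eval a = 0) ∧ ∀ g ∈ N₀, g.eval a ≠ 0) →
    ∃ a : Fin r → U, (∀ f ∈ E, f.eval a = 0) ∧ ∀ g ∈ N, g.eval a ≠ 0

end Closed

/-- `K` is a `Δ`-closed field (a model of `DCF_{0,m}` if `Δ` has `m` elements): it has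
characteristic zero, and it is existentially closed among its `Δ`-field extensions, that is, every
finite system of `Δ`-polynomial equations and an inequation over `K` that has a solution in some
`Δ`-field extension of `K` has a solution in `K`. -/
def IsDeltaClosedField (ι : Type w) (K : Type u) [Field K] [DeltaRing ι K] : Prop :=
  CharZero K ∧
  ∀ (r : ℕ) (E : Finset (DeltaPoly ι (Fin r) K)) (g : DeltaPoly ι (Fin r) K),
    (∃ (L : Type u) (_ : Field L) (_ : DeltaRing ι L) (_ : Algebra K L) (_ : DeltaAlgebra ι K L)
      (a : Fin r → L), (∀ f ∈ E, f.eval a = 0) ∧ g.eval a ≠ 0) →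
    ∃ a : Fin r → K, (∀ f ∈ E, f.eval a = 0) ∧ g.eval a ≠ 0

/-- The point `[y : 1]` of `P^1`. -/
def affinePoint {U : Type v} [Field U] (y : U) : ℙ U (Fin (1 + 1) → U) :=
  Projectivization.mk U ![y, 1] (fun h => one_ne_zero (congrFun h 1))

/-- The subset of `A^1 × A^1 ⊆ P^1 × A^1` given by `z (δ y)^2 + y^4 - 1 = 0` and
`2 z δ^2 y + δ z δ y + 4 y^3 = 0`, where `δ = d j`. -/
def kolchinSet {ι : Type w} (U : Type v) [Field U] [DeltaRing ι U] (j : ι) :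
    Set (ℙ U (Fin (1 + 1) → U) × (Fin 1 → U)) :=
  let δ : U →+ U := DeltaRing.d j
  {p | ∃ y z : U, p = (affinePoint y, ![z]) ∧
    z * δ y ^ 2 + y ^ 4 - 1 = 0 ∧ 2 * z * δ (δ y) + δ z * δ y + 4 * y ^ 3 = 0}

/-!
The projection of `kolchinSet U j` to the affine line is the complement of the origin
(`IsDeltaClosedField.snd_image_kolchinSet`), and the complement of the origin is not `Δ`-closed.

At `z = 0` the two equations read `y ^ 4 = 1` and `4 y ^ 3 = 0`, which is impossible. For `z ≠ 0`,
a solution `y` is sought in a `Δ`-extension of `U`; as `U` is existentially closed, there is then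
one in `U` (`IsDeltaClosedField.exists_kolchin`). First, `U` contains a square root `s` of `z⁻¹`,
because the derivations of `U` extend to `U(√z⁻¹)`. The Taylor series
`x ↦ ∑ δ^n x / n! X^n` embed `U` into `U⟦X⟧`, on which `δ` acts as `d/dX` and the other
derivations act on the coefficients. Over `U⟦X⟧` the system `y' = s w`, `w' = -2 y³ s` has a formal
solution starting at `(0, 1)`, found as the fixed point of a contraction
(`PowerSeries.exists_lemniscate`). It stays on the curve `w² + y⁴ = 1`, since the derivative of
`w² + y⁴` is zero, and the two equations for `y` follow. The second equation excludes the constant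
solutions with `y ^ 4 = 1`, which would otherwise be there for `z = 0` too.

A nonzero `Δ`-polynomial over `F` does not vanish on all of `U`, since it does not vanish at the
generic point of the `Δ`-field extension `U⟨y⟩` (`IsDeltaClosedField.exists_eval_ne_zero`). If `f`
vanishes on the complement of the origin, then `z f` vanishes everywhere, so `f = 0` and `f` also
vanishes at the origin. The same fact makes the set of conditions `f(b) ≠ 0` finitely satisfiable,
which gives a `Δ`-transcendental `b` over a saturated field.

To see that `P^n` is not `Δ`-complete, the equations are homogenized in `y` and `z`
(`kolchinForm₁`, `kolchinForm₂`) and the line `P^1` is embedded into `P^n` by its first two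
coordinates. The form of the first equation has no zero with `y₁ = 0 ≠ z₁`, so over the affine line
in `P^1` nothing is added at infinity, and the projection is again the complement of the origin.
-/

/-! ### Derivative operators and evaluation -/

section Eval

namespace DeltaPoly

variable {ι : Type w} {σ R A : Type*} [CommRing R] [CommRing A] [DeltaRing ι A] [Algebra R A]
  (a : σ → A) (f g : DeltaPoly ι σ R)

@[simp] theorem eval_zero : eval a (0 : DeltaPoly ι σ R) = 0 := map_zero (MvPolynomial.aeval _)

@[simp] theorem eval_one : eval a (1 : DeltaPoly ι σ R) = 1 := map_one (MvPolynomial.aeval _)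

@[simp] theorem eval_ofNat (n : ℕ) [n.AtLeastTwo] :
    eval a (ofNat(n) : DeltaPoly ι σ R) = ofNat(n) :=
  map_ofNat (MvPolynomial.aeval _) n

@[simp] theorem eval_add : eval a (f + g) = eval a f + eval a g :=
  map_add (MvPolynomial.aeval _) f g

@[simp] theorem eval_sub : eval a (f - g) = eval a f - eval a g :=
  map_sub (MvPolynomial.aeval _) f g

@[simp] theorem eval_mul : eval a (f * g) = eval a f * eval a g :=
  map_mul (MvPolynomial.aeval _) f g

@[simp] theorem eval_pow (n : ℕ) : eval a (f ^ n) = eval a f ^ n :=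
  map_pow (MvPolynomial.aeval _) f n

@[simp] theorem eval_C (c : R) : eval a (MvPolynomial.C c : DeltaPoly ι σ R) = algebraMap R A c :=
  MvPolynomial.aeval_C _ c

@[simp] theorem eval_X (p : σ × Multiset ι) :
    eval a (MvPolynomial.X p : DeltaPoly ι σ R) = deltaOp p.2 (a p.1) :=
  MvPolynomial.aeval_X _ p

end DeltaPoly

end Eval

section Basic

variable {ι : Type w} {R : Type*} [CommRing R] [DeltaRing ι R]

theorem DeltaRing.d_one (j : ι) : DeltaRing.d j (1 : R) = 0 := by
  simpa using DeltaRing.d_mul j (1 : R) 1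

theorem DeltaRing.d_natCast (j : ι) (n : ℕ) : DeltaRing.d j (n : R) = 0 := by
  rw [← nsmul_one, map_nsmul, DeltaRing.d_one, nsmul_zero]

@[simp]
theorem deltaOp_zero (x : R) : deltaOp (0 : Multiset ι) x = x := by
  simp [deltaOp]

@[simp]
theorem deltaOp_cons (j : ι) (θ : Multiset ι) (x : R) :
    deltaOp (j ::ₘ θ) x = DeltaRing.d j (deltaOp θ x) := by
  simp [deltaOp]

@[simp]
theorem deltaOp_singleton (j : ι) (x : R) : deltaOp {j} x = DeltaRing.d j x := by
  rw [← Multiset.cons_zero, deltaOp_cons, deltaOp_zero]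

theorem map_deltaOp {S : Type*} [CommRing S] [DeltaRing ι S] (φ : R →+* S)
    (hφ : ∀ (j : ι) (x : R), φ (DeltaRing.d j x) = DeltaRing.d j (φ x)) (θ : Multiset ι) (x : R) :
    φ (deltaOp θ x) = deltaOp θ (φ x) := by
  induction θ using Multiset.induction_on with
  | empty => simp
  | cons j θ ih => simp [hφ, ih]

namespace DeltaPoly

variable {σ : Type*}

theorem deltaOp_X (s : σ) (θ : Multiset ι) :
    deltaOp θ (MvPolynomial.X (s, 0) : DeltaPoly ι σ R) = MvPolynomial.X (s, θ) := by
  induction θ using Multiset.induction_on with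
  | empty => simp
  | cons j θ ih => rw [deltaOp_cons, ih]; exact der_X j s θ

variable {A : Type*} [CommRing A] [DeltaRing ι A] [Algebra R A]

/-- The evaluation of `Δ`-polynomials commutes with the derivations. -/
theorem eval_d [DeltaAlgebra ι R A] (a : σ → A) (j : ι) (f : DeltaPoly ι σ R) :
    eval a (DeltaRing.d j f) = DeltaRing.d j (eval a f) := by
  change eval a (der j f) = _
  induction f using MvPolynomial.induction_on with
  | C x =>
    rw [der_C]
    simp [eval, DeltaAlgebra.d_algebraMap]
  | add p q hp hq => simp only [eval, map_add] at hp hq ⊢; rw [hp, hq]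
  | mul_X p s hp =>
    obtain ⟨s, θ⟩ := s
    rw [der_mul, der_X]
    simp only [eval, map_add, map_mul, MvPolynomial.aeval_X, DeltaRing.d_mul,
      deltaOp_cons] at hp ⊢
    rw [hp]

/-- Substituting into a `Δ`-polynomial and then evaluating is evaluating at the values. -/
theorem eval_eval [DeltaAlgebra ι R A] {τ : Type*} (a : τ → A) (q : σ → DeltaPoly ι τ R)
    (f : DeltaPoly ι σ R) : eval a (eval q f) = eval (fun s => eval a (q s)) f := by
  have h : ∀ (θ : Multiset ι) (g : DeltaPoly ι τ R),
      eval a (deltaOp θ g) = deltaOp θ (eval a g) :=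
    map_deltaOp (MvPolynomial.aeval fun p : τ × Multiset ι => deltaOp p.2 (a p.1)).toRingHom
      fun j x => eval_d a j x
  induction f using MvPolynomial.induction_on with
  | C c => simp only [eval_C, MvPolynomial.algebraMap_eq]
  | add p q hp hq => simp only [eval_add, hp, hq]
  | mul_X p s hp => simp only [eval_mul, hp, eval_X, h]

/-- The `Δ`-homogeneity of `f` gives `f(c a) = c ^ e f(a)` for every `c` in a `Δ`-algebra. -/
theorem IsHomogeneousIn.eval_smul [DeltaAlgebra ι R A] {f : DeltaPoly ι σ R} {e : ℕ}
    (hf : f.IsHomogeneousIn Set.univ e) (c : A) (a : σ → A) :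
    eval (fun s => c * a s) f = c ^ e * eval a f := by
  have h := congrArg (eval (fun s : Option σ => s.elim c a)) hf
  simpa only [Set.mem_univ, if_true, eval_eval, eval_mul, eval_pow, eval_X, deltaOp_zero,
    Option.elim] using h

end DeltaPoly

end Basic

/-! ### The fraction field of a `Δ`-domain -/

section FractionField

variable {ι : Type w} {A : Type u} [CommRing A] [IsDomain A] [DeltaRing ι A]

namespace DeltaRing

/-- The ring homomorphism `a ↦ a + ε d j a` to the dual numbers over the fraction field. -/
noncomputable def toDualNumber (j : ι) : A →+* DualNumber (FractionRing A) where
  toFun a := TrivSqZeroExt.inl (algebraMap A _ a) + TrivSqZeroExt.inr (algebraMap A _ (d j a))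
  map_zero' := by simp
  map_one' := by simp [d_one]
  map_add' a b := by ext <;> simp [Algebra.smul_def]
  map_mul' a b := by
    ext
    · simp
    · simp only [d_mul, map_add, map_mul, TrivSqZeroExt.snd_add, TrivSqZeroExt.snd_inl,
        TrivSqZeroExt.snd_inr, TrivSqZeroExt.snd_mul, TrivSqZeroExt.fst_add, TrivSqZeroExt.fst_inl,
        TrivSqZeroExt.fst_inr, op_smul_eq_smul, smul_eq_mul]
      ring

/-- The extension of `toDualNumber` to the fraction field. It exists because an element of the
dual numbers whose first component is nonzero is a unit. -/
noncomputable def fractionRingToDualNumber (j : ι) :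
    FractionRing A →+* DualNumber (FractionRing A) :=
  IsLocalization.lift (M := nonZeroDivisors A) (g := toDualNumber j) fun y => by
    rw [TrivSqZeroExt.isUnit_iff_isUnit_fst]
    simp [toDualNumber]

theorem fractionRingToDualNumber_algebraMap (j : ι) (a : A) :
    fractionRingToDualNumber j (algebraMap A _ a) = toDualNumber j a :=
  IsLocalization.lift_eq _ _

theorem fst_fractionRingToDualNumber (j : ι) (x : FractionRing A) :
    (fractionRingToDualNumber j x).fst = x := by
  have h : ((TrivSqZeroExt.fstHom (FractionRing A) (FractionRing A)
      (FractionRing A)).toRingHom.comp (fractionRingToDualNumber j)) = RingHom.id _ := by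
    refine IsLocalization.ringHom_ext (nonZeroDivisors A) ?_
    ext a
    simp [fractionRingToDualNumber_algebraMap, toDualNumber]
  exact DFunLike.congr_fun h x

/-- The unique extension of the derivation `d j` to the fraction field. -/
noncomputable def fractionRingDer (j : ι) : FractionRing A →+ FractionRing A where
  toFun x := (fractionRingToDualNumber j x).snd
  map_zero' := by simp
  map_add' x y := by simp

theorem fractionRingDer_algebraMap (j : ι) (a : A) :
    fractionRingDer j (algebraMap A (FractionRing A) a) = algebraMap A _ (d j a) := by
  simp [fractionRingDer, fractionRingToDualNumber_algebraMap, toDualNumber]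
  exact (Algebra.algebraMap_eq_smul_one _).symm

theorem fractionRingDer_mul (j : ι) (x y : FractionRing A) :
    fractionRingDer j (x * y) = x * fractionRingDer j y + fractionRingDer j x * y := by
  simp [fractionRingDer, fst_fractionRingToDualNumber]

/-- The fraction field of a `Δ`-domain is a `Δ`-field. -/
noncomputable instance : DeltaRing ι (FractionRing A) where
  d := fractionRingDer
  d_mul := fractionRingDer_mul
  d_comm i j x := by
    obtain ⟨a, b, hb, rfl⟩ := IsFractionRing.div_surjective (A := A) x
    have hb' : algebraMap A (FractionRing A) b ≠ 0 := by
      simpa using nonZeroDivisors.ne_zero hb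
    set x := algebraMap A (FractionRing A) a / algebraMap A (FractionRing A) b
    have hx : algebraMap A (FractionRing A) b * x = algebraMap A _ a := by
      simp only [x]; field_simp
    have h (i j : ι) := congrArg (fun y => fractionRingDer i (fractionRingDer j y)) hx
    have h₁ := h i j
    have h₂ := h j i
    simp only [fractionRingDer_mul, map_add, fractionRingDer_algebraMap] at h₁ h₂
    rw [d_comm j i a, d_comm j i b] at h₂
    refine mul_left_cancel₀ hb' ?_
    linear_combination h₁ - h₂

end DeltaRing

/-- A `Δ`-closed field `K` solves every system that is solvable in a `Δ`-domain `A` over `K`. -/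
theorem IsDeltaClosedField.exists_eval_of_ringHom {K : Type u} [Field K] [DeltaRing ι K]
    (hK : IsDeltaClosedField ι K) (φ : K →+* A)
    (hφ : ∀ (j : ι) (x : K), φ (DeltaRing.d j x) = DeltaRing.d j (φ x)) {r : ℕ} (a : Fin r → A)
    (E : Finset (DeltaPoly ι (Fin r) K)) (g : DeltaPoly ι (Fin r) K)
    (hE : ∀ f ∈ E, MvPolynomial.eval₂ φ (fun p => deltaOp p.2 (a p.1)) f = 0)
    (hg : MvPolynomial.eval₂ φ (fun p => deltaOp p.2 (a p.1)) g ≠ 0) :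
    ∃ a : Fin r → K, (∀ f ∈ E, f.eval a = 0) ∧ g.eval a ≠ 0 := by
  let ψ := algebraMap A (FractionRing A)
  have hψ : ∀ (j : ι) (x : A), ψ (DeltaRing.d j x) = DeltaRing.d j (ψ x) := fun j x =>
    (DeltaRing.fractionRingDer_algebraMap j x).symm
  let _ : Algebra K (FractionRing A) := (ψ.comp φ).toAlgebra
  have key (f : DeltaPoly ι (Fin r) K) : f.eval (fun s => ψ (a s)) =
      ψ (MvPolynomial.eval₂ φ (fun p => deltaOp p.2 (a p.1)) f) := by
    rw [MvPolynomial.hom_eval₂]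
    change MvPolynomial.eval₂ (ψ.comp φ) _ f = _
    congr 1
    funext p
    exact (map_deltaOp ψ hψ _ _).symm
  refine hK.2 r E g ⟨FractionRing A, inferInstance, inferInstance, inferInstance, ⟨fun j x => ?_⟩,
    fun s => ψ (a s), fun f hf => by rw [key, hE f hf, map_zero], ?_⟩
  · exact ((congrArg ψ (hφ j x)).trans (hψ j _)).symm
  · rw [key]
    exact fun h => hg (IsFractionRing.injective A (FractionRing A) (h.trans (map_zero ψ).symm))

end FractionField

/-! ### Square roots in `Δ`-closed fields -/

section SquareRoot

variable {ι : Type w} {K : Type u} [Field K] [DeltaRing ι K]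

/-- The extension of the derivations of `K` to `K(√c)`, given by `δ √c = (δ c / 2 c) √c`. -/
@[reducible]
noncomputable def QuadraticAlgebra.deltaRing [CharZero K] {c : K} (hc : c ≠ 0) :
    DeltaRing ι (QuadraticAlgebra K c 0) where
  d j :=
    { toFun x := ⟨DeltaRing.d j x.re, DeltaRing.d j x.im + x.im * (DeltaRing.d j c / (2 * c))⟩
      map_zero' := by ext <;> simp
      map_add' x y := by
        ext
        · simp
        · simp
          ring }
  d_mul j x y := by
    ext
    · simp [DeltaRing.d_mul]
      field_simp
      ring
    · simp [DeltaRing.d_mul]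
      ring
  d_comm i j x := by
    -- `δ c / 2 c` is half the logarithmic derivative of `c`.
    have h : DeltaRing.d i (DeltaRing.d j c / (2 * c)) =
        DeltaRing.d j (DeltaRing.d i c / (2 * c)) := by
      have h2 (i : ι) : DeltaRing.d i (2 * c) = 2 * DeltaRing.d i c := by
        rw [two_mul, map_add, two_mul]
      have hdiv (i j : ι) : DeltaRing.d i (DeltaRing.d j c) =
          DeltaRing.d j c / (2 * c) * (2 * DeltaRing.d i c) +
            DeltaRing.d i (DeltaRing.d j c / (2 * c)) * (2 * c) := by
        rw [← h2, ← DeltaRing.d_mul]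
        field_simp
      refine mul_right_cancel₀ (mul_ne_zero two_ne_zero hc) ?_
      have := DeltaRing.d_comm i j c
      rw [hdiv i j, hdiv j i] at this
      linear_combination this
    ext
    · exact DeltaRing.d_comm i j x.re
    · simp only [AddMonoidHom.coe_mk, ZeroHom.coe_mk, map_add, DeltaRing.d_mul, h,
        DeltaRing.d_comm i j x.im]
      ring

/-- A `Δ`-closed field contains the square roots of its nonzero elements. -/
theorem IsDeltaClosedField.exists_sq_eq (hK : IsDeltaClosedField ι K) {c : K} (hc : c ≠ 0) :
    ∃ s : K, s ^ 2 = c := by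
  have := hK.1
  by_contra! hsq
  have : Fact (∀ r : K, r ^ 2 ≠ c + 0 * r) := ⟨fun r => by simpa using hsq r⟩
  let _ := QuadraticAlgebra.deltaRing (ι := ι) hc
  obtain ⟨a, ha, -⟩ := hK.exists_eval_of_ringHom (algebraMap K (QuadraticAlgebra K c 0))
    (fun j x => by
      ext
      · rfl
      · change 0 = DeltaRing.d j (0 : K) + 0 * _
        simp) (fun _ : Fin 1 => ⟨0, 1⟩)
    {MvPolynomial.X (0, 0) ^ 2 - MvPolynomial.C c} 1
    (by
      intro f hf
      rw [Finset.mem_singleton] at hf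
      subst hf
      simp only [MvPolynomial.eval₂_sub, MvPolynomial.eval₂_pow, MvPolynomial.eval₂_X,
        MvPolynomial.eval₂_C, deltaOp_zero]
      ext <;> simp [sq])
    (by simp)
  have h := ha _ (Finset.mem_singleton_self _)
  simp only [DeltaPoly.eval_sub, DeltaPoly.eval_pow, DeltaPoly.eval_X, deltaOp_zero,
    DeltaPoly.eval_C, Algebra.algebraMap_self, RingHom.id_apply] at h
  exact hsq _ (sub_eq_zero.1 h)

end SquareRoot

/-! ### Taylor series and formal differential equations -/

namespace PowerSeries

section Taylor

variable {ι : Type w} {K : Type u} [Field K] [DeltaRing ι K]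

/-- The derivation `d i` applied to every coefficient of a power series. -/
noncomputable def coeffDer (i : ι) : K⟦X⟧ →+ K⟦X⟧ where
  toFun f := mk fun n => DeltaRing.d i (coeff n f)
  map_zero' := by ext; simp
  map_add' f g := by ext; simp

theorem coeff_coeffDer (i : ι) (f : K⟦X⟧) (n : ℕ) :
    coeff n (coeffDer i f) = DeltaRing.d i (coeff n f) := by
  simp [coeffDer]

theorem coeffDer_mul (i : ι) (f g : K⟦X⟧) :
    coeffDer i (f * g) = f * coeffDer i g + coeffDer i f * g := by
  ext n
  simp only [coeff_coeffDer, coeff_mul, map_add, map_sum, DeltaRing.d_mul, Finset.sum_add_distrib]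

theorem coeffDer_derivative (i : ι) (f : K⟦X⟧) :
    coeffDer i (derivative K f) = derivative K (coeffDer i f) := by
  ext n
  have h : DeltaRing.d i ((n : K) + 1) = 0 := by
    rw [map_add, DeltaRing.d_natCast, DeltaRing.d_one, add_zero]
  simp only [coeff_coeffDer, coeff_derivative, DeltaRing.d_mul, h, mul_zero, zero_add]

open Classical in
/-- The `Δ`-ring structure on `K⟦X⟧` for which `d j` is `d/dX` and the other derivations act on
the coefficients. -/
@[reducible]
noncomputable def deltaRing (j : ι) : DeltaRing ι K⟦X⟧ where
  d i := if i = j then (derivative K).toLinearMap.toAddMonoidHom else coeffDer i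
  d_mul i f g := by
    split_ifs
    · change derivative K (f * g) = f * derivative K g + derivative K f * g
      rw [Derivation.leibniz, smul_eq_mul, smul_eq_mul, mul_comm g]
    · exact coeffDer_mul i f g
  d_comm i k f := by
    split_ifs
    · rfl
    · exact (coeffDer_derivative k f).symm
    · exact coeffDer_derivative i f
    · ext n
      simp only [coeff_coeffDer, DeltaRing.d_comm i k]

theorem deltaRing_d_self (j : ι) (f : K⟦X⟧) :
    letI := deltaRing (K := K) j
    DeltaRing.d j f = derivative K f := by
  simp [DeltaRing.d]

theorem deltaRing_d_of_ne {i j : ι} (h : i ≠ j) (f : K⟦X⟧) :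
    letI := deltaRing (K := K) j
    DeltaRing.d i f = coeffDer i f := by
  simp [DeltaRing.d, h]

/-- The Taylor series `∑ (d j)^n x / n! X^n` of `x`. -/
noncomputable def taylorSeries (j : ι) (x : K) : K⟦X⟧ :=
  mk fun n => ((n.factorial : K)⁻¹) • (DeltaRing.d j)^[n] x

theorem derivative_taylorSeries [CharZero K] (j : ι) (x : K) :
    derivative K (taylorSeries j x) = taylorSeries j (DeltaRing.d j x) := by
  ext n
  have h : ((n.factorial : ℕ) : K) ≠ 0 := Nat.cast_ne_zero.2 n.factorial_ne_zero
  have h' : (n : K) + 1 ≠ 0 := Nat.cast_add_one_ne_zero n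
  simp only [coeff_derivative, taylorSeries, coeff_mk, Nat.factorial_succ, smul_eq_mul,
    Function.iterate_succ_apply, Nat.cast_mul, Nat.cast_succ]
  field_simp

theorem taylorSeries_add (j : ι) (x y : K) :
    taylorSeries j (x + y) = taylorSeries j x + taylorSeries j y := by
  ext n
  simp [taylorSeries, iterate_map_add, mul_add]

/-- The coefficients are compared by induction on their order: the derivatives of both sides are
sums of the two sides of the same identity for `(x, δ y)` and `(δ x, y)`. -/
theorem taylorSeries_mul [CharZero K] (j : ι) (x y : K) :
    taylorSeries j (x * y) = taylorSeries j x * taylorSeries j y := by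
  ext n
  induction n generalizing x y with
  | zero => simp [taylorSeries]
  | succ n ih =>
    have h : derivative K (taylorSeries j x * taylorSeries j y) = taylorSeries j x *
        taylorSeries j (DeltaRing.d j y) + taylorSeries j (DeltaRing.d j x) * taylorSeries j y := by
      rw [Derivation.leibniz, derivative_taylorSeries, derivative_taylorSeries, smul_eq_mul,
        smul_eq_mul, mul_comm (taylorSeries j y)]
    have h' : derivative K (taylorSeries j (x * y)) = taylorSeries j (x * DeltaRing.d j y) +
        taylorSeries j (DeltaRing.d j x * y) := by
      rw [derivative_taylorSeries, DeltaRing.d_mul, taylorSeries_add]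
    refine mul_right_cancel₀ (Nat.cast_add_one_ne_zero n : (n : K) + 1 ≠ 0) ?_
    rw [← coeff_derivative, ← coeff_derivative, h, h', map_add, map_add, ih, ih]

/-- The Taylor series embedding `K → K⟦X⟧`. -/
noncomputable def taylorHom [CharZero K] (j : ι) : K →+* K⟦X⟧ where
  toFun := taylorSeries j
  map_one' := by
    ext n
    cases n <;> simp [taylorSeries, Function.iterate_succ_apply, DeltaRing.d_one, coeff_one]
  map_mul' := taylorSeries_mul j
  map_zero' := by ext n; simp [taylorSeries]
  map_add' := taylorSeries_add j

theorem taylorHom_d [CharZero K] (i j : ι) (x : K) :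
    letI := deltaRing (K := K) j
    taylorHom j (DeltaRing.d i x) = DeltaRing.d i (taylorHom j x) := by
  by_cases h : i = j
  · subst h
    rw [deltaRing_d_self]
    exact (derivative_taylorSeries i x).symm
  · rw [deltaRing_d_of_ne h]
    ext n
    have hc : (DeltaRing.d j)^[n] (DeltaRing.d i x) = DeltaRing.d i ((DeltaRing.d j)^[n] x) :=
      Function.Commute.iterate_left (fun x => DeltaRing.d_comm j i x) n x
    rw [coeff_coeffDer]
    simp only [taylorHom, taylorSeries, RingHom.coe_mk, MonoidHom.coe_mk, OneHom.coe_mk, coeff_mk,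
      hc]
    rw [map_inv_natCast_smul (DeltaRing.d i) K K]

end Taylor

section Contraction

variable {R : Type*} [CommRing R]

/-- A map of tuples of power series that increases the order of contact has a fixed point:
the iterates of `0` converge `X`-adically to it. -/
theorem exists_fixedPoint {τ : Type*} (Φ : (τ → R⟦X⟧) → τ → R⟦X⟧)
    (hΦ : ∀ (k : ℕ) (u v : τ → R⟦X⟧), (∀ i, X ^ k ∣ u i - v i) →
      ∀ i, X ^ (k + 1) ∣ Φ u i - Φ v i) : ∃ u, Φ u = u := by
  have hstep (k : ℕ) : ∀ i, X ^ k ∣ Φ^[k + 1] 0 i - Φ^[k] 0 i := by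
    induction k with
    | zero => simp
    | succ k ih =>
      have h := hΦ k _ _ ih
      rwa [← Function.iterate_succ_apply' Φ, ← Function.iterate_succ_apply' Φ] at h
  have hle {k l : ℕ} (hkl : k ≤ l) : ∀ i, X ^ k ∣ Φ^[l] 0 i - Φ^[k] 0 i := by
    induction l, hkl using Nat.le_induction with
    | base => simp
    | succ l hkl ih =>
      intro i
      rw [← sub_add_sub_cancel _ (Φ^[l] 0 i)]
      exact dvd_add ((pow_dvd_pow X hkl).trans (hstep l i)) (ih i)
  let u : τ → R⟦X⟧ := fun i => mk fun n => coeff n (Φ^[n + 1] 0 i)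
  have hu (k : ℕ) (i : τ) : X ^ k ∣ u i - Φ^[k] 0 i := by
    refine X_pow_dvd_iff.2 fun n hn => ?_
    have := X_pow_dvd_iff.1 (hle (Nat.succ_le_of_lt hn) i) n n.lt_succ_self
    rw [map_sub, sub_eq_zero] at this ⊢
    rw [coeff_mk, this]
  refine ⟨u, funext fun i => ?_⟩
  ext n
  -- `Φ u` and `u` both agree with the iterate `Φ^[n + 1] 0` up to order `n`.
  have h := dvd_sub (hΦ n _ _ (hu n) i) (Function.iterate_succ_apply' Φ n 0 ▸ hu (n + 1) i)
  rw [sub_sub_sub_cancel_right] at h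
  simpa [sub_eq_zero] using X_pow_dvd_iff.1 h n n.lt_succ_self

variable {K : Type*} [Field K]

/-- The formal antiderivative with constant term zero. -/
noncomputable def integral (f : K⟦X⟧) : K⟦X⟧ :=
  X * mk fun n => coeff n f / (n + 1)

theorem derivative_integral [CharZero K] (f : K⟦X⟧) : derivative K (integral f) = f := by
  ext n
  have h : (n : K) + 1 ≠ 0 := Nat.cast_add_one_ne_zero n
  rw [coeff_derivative, integral, coeff_succ_X_mul, coeff_mk]
  field_simp

theorem X_pow_dvd_integral_sub {k : ℕ} {f g : K⟦X⟧} (h : X ^ k ∣ f - g) :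
    X ^ (k + 1) ∣ integral f - integral g := by
  rw [integral, integral, ← mul_sub, pow_succ']
  refine mul_dvd_mul_left X (X_pow_dvd_iff.2 fun n hn => ?_)
  have := X_pow_dvd_iff.1 h n hn
  rw [map_sub, sub_eq_zero] at this ⊢
  rw [coeff_mk, coeff_mk, this]

/-- The lemniscate sine and its derivative, reparametrized so that the speed is `q`: a formal
solution of `y' = q w`, `w' = -2 y³ q` on the curve `w² + y⁴ = 1`, starting at the point
`(0, 1)`. -/
theorem exists_lemniscate [CharZero K] (q : K⟦X⟧) : ∃ y w : K⟦X⟧,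
    derivative K y = q * w ∧ derivative K w = -2 * y ^ 3 * q ∧ w ^ 2 + y ^ 4 = 1 := by
  obtain ⟨u, hu⟩ := exists_fixedPoint (R := K) (τ := Fin 2)
    (fun u => ![integral (q * u 1), 1 + integral (-2 * u 0 ^ 3 * q)]) (by
      intro k u v h i
      fin_cases i
      · refine X_pow_dvd_integral_sub ?_
        rw [← mul_sub]
        exact (h 1).mul_left q
      · simp only [Fin.mk_one, Matrix.cons_val_one, Matrix.cons_val_fin_one,
          add_sub_add_left_eq_sub]
        refine X_pow_dvd_integral_sub ?_
        rw [← sub_mul, ← mul_sub]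
        exact (((h 0).trans (sub_dvd_pow_sub_pow _ _ 3)).mul_left _).mul_right _)
  have h0 : u 0 = integral (q * u 1) := (congrFun hu 0).symm
  have h1 : u 1 = 1 + integral (-2 * u 0 ^ 3 * q) := (congrFun hu 1).symm
  have hd0 : derivative K (u 0) = q * u 1 := by
    conv_lhs => rw [h0, derivative_integral]
  have hd1 : derivative K (u 1) = -2 * u 0 ^ 3 * q := by
    conv_lhs => rw [h1, map_add, derivative_one, zero_add, derivative_integral]
  refine ⟨u 0, u 1, hd0, hd1, derivative.ext ?_ ?_⟩
  · rw [map_add, derivative_pow, derivative_pow, hd0, hd1, derivative_one]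
    push_cast
    ring
  · have c0 : constantCoeff (u 0) = 0 := by rw [h0]; simp [integral]
    have c1 : constantCoeff (u 1) = 1 := by rw [h1]; simp [integral]
    simp [c0, c1]

end Contraction

end PowerSeries

/-! ### Solutions of the affine equations -/

/-- In a `Δ`-closed field, the system defining `kolchinSet` has a solution `y` for every
nonzero value of `z`. It is found over `K⟦X⟧` in the form `δ y = s w`, `δ w = -2 y³ s`,
`w² + y⁴ = 1`, where `z s² = 1`; these equations imply both equations of the system. -/
theorem IsDeltaClosedField.exists_kolchin {ι : Type w} {K : Type u} [Field K] [DeltaRing ι K]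
    (hK : IsDeltaClosedField ι K) (j : ι) {z : K} (hz : z ≠ 0) : ∃ y : K,
    z * DeltaRing.d j y ^ 2 + y ^ 4 - 1 = 0 ∧
    2 * z * DeltaRing.d j (DeltaRing.d j y) + DeltaRing.d j z * DeltaRing.d j y +
      4 * y ^ 3 = 0 := by
  have := hK.1
  obtain ⟨s, hs⟩ := hK.exists_sq_eq (inv_ne_zero hz)
  have hzs : z * s ^ 2 = 1 := by rw [hs, mul_inv_cancel₀ hz]
  obtain ⟨y, w, hy, hw, hyw⟩ := PowerSeries.exists_lemniscate (PowerSeries.taylorHom j s)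
  let _ := PowerSeries.deltaRing (K := K) j
  classical
  let X (i : Fin 2) (θ : Multiset ι) : DeltaPoly ι (Fin 2) K := MvPolynomial.X (i, θ)
  obtain ⟨a, ha, -⟩ := hK.exists_eval_of_ringHom (PowerSeries.taylorHom j)
    (fun i x => PowerSeries.taylorHom_d i j x) ![y, w]
    {X 0 {j} - MvPolynomial.C s * X 1 0, X 1 {j} + 2 * X 0 0 ^ 3 * MvPolynomial.C s,
      X 1 0 ^ 2 + X 0 0 ^ 4 - 1} 1
    (by
      intro f hf
      simp only [Finset.mem_insert, Finset.mem_singleton] at hf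
      obtain rfl | rfl | rfl := hf
      · simp [X, PowerSeries.deltaRing_d_self, hy]
      · simp [X, PowerSeries.deltaRing_d_self, hw]
      · simp [X, hyw])
    (by simp)
  simp only [Finset.mem_insert, Finset.mem_singleton, forall_eq_or_imp, forall_eq, X,
    DeltaPoly.eval_sub, DeltaPoly.eval_add, DeltaPoly.eval_mul, DeltaPoly.eval_pow,
    DeltaPoly.eval_one, DeltaPoly.eval_ofNat, DeltaPoly.eval_X, DeltaPoly.eval_C, deltaOp_zero,
    deltaOp_singleton, Algebra.algebraMap_self, RingHom.id_apply] at ha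
  obtain ⟨h1, h2, h3⟩ := ha
  have h1' : DeltaRing.d j (a 0) = s * a 1 := sub_eq_zero.1 h1
  have hzs' := congrArg (DeltaRing.d j) hzs
  rw [sq, DeltaRing.d_mul, DeltaRing.d_mul, DeltaRing.d_one] at hzs'
  have hs0 : s ≠ 0 := by rintro rfl; simp at hzs
  refine ⟨a 0, ?_, ?_⟩
  · rw [h1']
    linear_combination a 1 ^ 2 * hzs + h3
  · rw [h1', DeltaRing.d_mul]
    refine mul_left_cancel₀ hs0 ?_
    linear_combination a 1 * hzs' + 2 * z * s ^ 2 * h2 - 4 * s * a 0 ^ 3 * hzs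

/-! ### Nonvanishing of `Δ`-polynomials on a `Δ`-closed field -/

section Nonvanishing

variable {ι : Type} {F : Type u} {U : Type v} [Field F] [Field U] [DeltaRing ι U] [Algebra F U]

/-- A nonzero `Δ`-polynomial does not vanish identically on a `Δ`-closed field: over `U`, it does
not vanish at the generic point, whose coordinates are the variables of `U{y}`. -/
theorem IsDeltaClosedField.exists_eval_ne_zero (hU : IsDeltaClosedField ι U) {r : ℕ}
    {f : DeltaPoly ι (Fin r) F} (hf : f ≠ 0) : ∃ a : Fin r → U, f.eval a ≠ 0 := by
  have hmap : MvPolynomial.map (algebraMap F U) f ≠ 0 := fun h =>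
    hf (MvPolynomial.map_injective _ (algebraMap F U).injective (h.trans (map_zero _).symm))
  obtain ⟨a, -, ha⟩ := hU.exists_eval_of_ringHom (A := DeltaPoly ι (Fin r) U) MvPolynomial.C
    (fun j x => (DeltaPoly.der_C j x).symm) (fun s => MvPolynomial.X (s, 0)) ∅
    (MvPolynomial.map (algebraMap F U) f) (by simp)
    (by simpa only [DeltaPoly.deltaOp_X, Prod.mk.eta, MvPolynomial.eval₂_eta] using hmap)
  refine ⟨a, ?_⟩
  rwa [DeltaPoly.eval, MvPolynomial.aeval_map_algebraMap] at ha

/-- Over a saturated `Δ`-closed field there are `Δ`-transcendental elements. -/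
theorem IsDeltaClosedField.exists_isDeltaTranscendental [DeltaRing ι F]
    (hU : IsDeltaClosedField ι U) (hsat : IsSaturatedOver ι F U) : ∃ b : U, IsDeltaTranscendental ι F b := by
  obtain ⟨a, -, ha⟩ := hsat 1 ∅ {f | f ≠ 0} fun E₀ N₀ hE hN => by
    have hE₀ : E₀ = ∅ := by simpa using hE
    obtain ⟨a, ha⟩ := hU.exists_eval_ne_zero
      (Finset.prod_ne_zero_iff.2 fun f hf => hN hf : ∏ f ∈ N₀, f ≠ 0)
    rw [DeltaPoly.eval, map_prod, Finset.prod_ne_zero_iff] at ha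
    exact ⟨a, by simp [hE₀], ha⟩
  refine ⟨a 0, fun f hf => ?_⟩
  rw [show ![a 0] = a from funext fun i => by fin_cases i; rfl]
  exact ha f hf

/-- The punctured affine line is not `Δ`-closed: a `Δ`-polynomial that vanishes on it vanishes
identically. -/
theorem IsDeltaClosedField.not_isDeltaClosedAffine_ne_zero (hU : IsDeltaClosedField ι U) :
    ¬ IsDeltaClosedAffine ι F {x : Fin 1 → U | x 0 ≠ 0} := by
  rintro ⟨E, hE⟩
  have h₀ : (0 : Fin 1 → U) ∉ {a | ∀ f ∈ E, f.eval a = 0} := by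
    rw [← hE]
    simp
  simp only [Set.mem_ofPred_eq, not_forall] at h₀
  obtain ⟨f, hfE, hf⟩ := h₀
  have hf₀ : f ≠ 0 := by
    rintro rfl
    exact hf (DeltaPoly.eval_zero _)
  -- Multiplying `f` by the coordinate ensures that the point found is not the origin.
  obtain ⟨a, ha⟩ := hU.exists_eval_ne_zero (mul_ne_zero (MvPolynomial.X_ne_zero (0, 0)) hf₀)
  rw [DeltaPoly.eval_mul, DeltaPoly.eval_X, deltaOp_zero] at ha
  have hmem : a ∈ {a | ∀ f ∈ E, f.eval a = 0} := hE ▸ left_ne_zero_of_mul ha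
  exact right_ne_zero_of_mul ha (hmem f hfE)

end Nonvanishing

/-! ### The homogenized equations -/

section Forms

variable {ι : Type w} {R : Type*} [CommRing R] [DeltaRing ι R]

/-- The Wronskian of `y₁` and `y₀`, so that `δ (y₀ / y₁) = deltaWronskian j y₀ y₁ / y₁ ^ 2`. -/
def deltaWronskian (j : ι) (y₀ y₁ : R) : R :=
  y₁ * DeltaRing.d j y₀ - y₀ * DeltaRing.d j y₁

/-- The first equation of `kolchinSet` at `y = y₀ / y₁` and `z = z₀ / z₁`, multiplied by
`y₁ ^ 4 * z₁`. -/
def kolchinForm₁ (j : ι) (y₀ y₁ z₀ z₁ : R) : R :=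
  z₀ * deltaWronskian j y₀ y₁ ^ 2 + z₁ * (y₀ ^ 4 - y₁ ^ 4)

/-- The second equation of `kolchinSet` at `y = y₀ / y₁` and `z = z₀ / z₁`, multiplied by
`y₁ ^ 3 * z₁ ^ 2`. -/
def kolchinForm₂ (j : ι) (y₀ y₁ z₀ z₁ : R) : R :=
  2 * z₀ * z₁ * (y₁ * DeltaRing.d j (deltaWronskian j y₀ y₁) -
    2 * deltaWronskian j y₀ y₁ * DeltaRing.d j y₁) +
    deltaWronskian j z₀ z₁ * deltaWronskian j y₀ y₁ * y₁ + 4 * z₁ ^ 2 * y₀ ^ 3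

theorem kolchinForm₁_mul_left (j : ι) (t y₀ y₁ z₀ z₁ : R) :
    kolchinForm₁ j (t * y₀) (t * y₁) z₀ z₁ = t ^ 4 * kolchinForm₁ j y₀ y₁ z₀ z₁ := by
  simp only [kolchinForm₁, deltaWronskian, DeltaRing.d_mul]
  ring

theorem kolchinForm₂_mul_left (j : ι) (t y₀ y₁ z₀ z₁ : R) :
    kolchinForm₂ j (t * y₀) (t * y₁) z₀ z₁ = t ^ 3 * kolchinForm₂ j y₀ y₁ z₀ z₁ := by
  simp only [kolchinForm₂, deltaWronskian, DeltaRing.d_mul, map_add, map_sub]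
  ring

theorem kolchinForm₁_mul_right (j : ι) (t y₀ y₁ z₀ z₁ : R) :
    kolchinForm₁ j y₀ y₁ (t * z₀) (t * z₁) = t * kolchinForm₁ j y₀ y₁ z₀ z₁ := by
  simp only [kolchinForm₁]
  ring

theorem kolchinForm₂_mul_right (j : ι) (t y₀ y₁ z₀ z₁ : R) :
    kolchinForm₂ j y₀ y₁ (t * z₀) (t * z₁) = t ^ 2 * kolchinForm₂ j y₀ y₁ z₀ z₁ := by
  simp only [kolchinForm₂, deltaWronskian, DeltaRing.d_mul]
  ring

theorem kolchinForm₁_one (j : ι) (y z : R) :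
    kolchinForm₁ j y 1 z 1 = z * DeltaRing.d j y ^ 2 + y ^ 4 - 1 := by
  simp only [kolchinForm₁, deltaWronskian, DeltaRing.d_one]
  ring

theorem kolchinForm₂_one (j : ι) (y z : R) :
    kolchinForm₂ j y 1 z 1 =
      2 * z * DeltaRing.d j (DeltaRing.d j y) + DeltaRing.d j z * DeltaRing.d j y + 4 * y ^ 3 := by
  simp only [kolchinForm₂, deltaWronskian, DeltaRing.d_one, mul_zero, sub_zero, one_mul]
  ring

namespace DeltaPoly

variable {σ : Type*} {A : Type*} [CommRing A] [DeltaRing ι A] [Algebra R A] [DeltaAlgebra ι R A]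

theorem eval_deltaWronskian (j : ι) (a : σ → A) (p q : DeltaPoly ι σ R) :
    eval a (deltaWronskian j p q) = deltaWronskian j (eval a p) (eval a q) := by
  simp only [deltaWronskian, eval_sub, eval_mul, eval_d]

@[simp]
theorem eval_kolchinForm₁ (j : ι) (a : σ → A) (p₀ p₁ q₀ q₁ : DeltaPoly ι σ R) :
    eval a (kolchinForm₁ j p₀ p₁ q₀ q₁) =
      kolchinForm₁ j (eval a p₀) (eval a p₁) (eval a q₀) (eval a q₁) := by
  simp only [kolchinForm₁, eval_sub, eval_add, eval_mul, eval_pow, eval_deltaWronskian]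

@[simp]
theorem eval_kolchinForm₂ (j : ι) (a : σ → A) (p₀ p₁ q₀ q₁ : DeltaPoly ι σ R) :
    eval a (kolchinForm₂ j p₀ p₁ q₀ q₁) =
      kolchinForm₂ j (eval a p₀) (eval a p₁) (eval a q₀) (eval a q₁) := by
  simp only [kolchinForm₂, eval_sub, eval_add, eval_mul, eval_pow, eval_d, eval_deltaWronskian,
    eval_ofNat]

end DeltaPoly

variable {K : Type*} [Field K] [DeltaRing ι K]

/-- The dehomogenization of the forms, at arbitrary homogeneous coordinates of `[y : 1]` and
`[z : 1]`. -/
theorem kolchinForms_eq_zero_iff (j : ι) {a c : K} (ha : a ≠ 0) (hc : c ≠ 0) (y z : K) :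
    (kolchinForm₁ j (a * y) a (c * z) c = 0 ∧ kolchinForm₂ j (a * y) a (c * z) c = 0) ↔
      z * DeltaRing.d j y ^ 2 + y ^ 4 - 1 = 0 ∧
      2 * z * DeltaRing.d j (DeltaRing.d j y) + DeltaRing.d j z * DeltaRing.d j y +
        4 * y ^ 3 = 0 := by
  have h₁ := kolchinForm₁_mul_left j a y 1 (c * z) c
  have h₁' := kolchinForm₁_mul_right j c y 1 z 1
  have h₂ := kolchinForm₂_mul_left j a y 1 (c * z) c
  have h₂' := kolchinForm₂_mul_right j c y 1 z 1
  rw [mul_one] at h₁ h₁' h₂ h₂'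
  rw [h₁, h₁', h₂, h₂', kolchinForm₁_one, kolchinForm₂_one]
  simp [ha, hc]

/-- The first form has no zero on the line at infinity `y₁ = 0`. -/
theorem eq_zero_of_kolchinForm₁_eq_zero (j : ι) {y₀ z₀ z₁ : K} (hz : z₁ ≠ 0)
    (h : kolchinForm₁ j y₀ 0 z₀ z₁ = 0) : y₀ = 0 := by
  simpa [kolchinForm₁, deltaWronskian, hz] using h

/-- At `z = 0`, the equations say that `y ^ 4 = 1` and `4 * y ^ 3 = 0`. -/
theorem not_kolchin_zero [CharZero K] (j : ι) (y : K) :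
    ¬ ((0 : K) * DeltaRing.d j y ^ 2 + y ^ 4 - 1 = 0 ∧
      2 * 0 * DeltaRing.d j (DeltaRing.d j y) + DeltaRing.d j (0 : K) * DeltaRing.d j y +
        4 * y ^ 3 = 0) := by
  rintro ⟨h₁, h₂⟩
  have hy : y = 0 := by simpa using h₂
  simp [hy] at h₁

end Forms

/-! ### The projection of the set -/

section Projection

variable {ι : Type} {F : Type u} {U : Type v} [Field F] [Field U] [DeltaRing ι F] [DeltaRing ι U]
  [Algebra F U]

theorem exists_rep_affinePoint (y : U) :
    ∃ c : U, c ≠ 0 ∧ (affinePoint y).rep 0 = c * y ∧ (affinePoint y).rep 1 = c := by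
  obtain ⟨c, hc⟩ := Projectivization.exists_smul_eq_mk_rep U ![y, 1]
    (fun h => one_ne_zero (congrFun h 1))
  refine ⟨c, c.ne_zero, ?_, ?_⟩
  · rw [affinePoint, ← hc]
    simp [Units.smul_def]
  · rw [affinePoint, ← hc]
    simp [Units.smul_def]

theorem eq_affinePoint (p : ℙ U (Fin (1 + 1) → U)) (hp : p.rep 1 ≠ 0) :
    p = affinePoint (p.rep 0 / p.rep 1) := by
  conv_lhs => rw [← p.mk_rep]
  rw [affinePoint, Projectivization.mk_eq_mk_iff']
  refine ⟨p.rep 1, funext fun i => ?_⟩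
  fin_cases i
  · simp [mul_div_cancel₀ _ hp]
  · simp

theorem isDeltaClosedProjAffine_kolchinSet [DeltaAlgebra ι F U] (j : ι) :
    IsDeltaClosedProjAffine ι F (kolchinSet U j) := by
  let Y (i : Fin (1 + 1)) : DeltaPoly ι (Fin (1 + 1) ⊕ Fin 1) F := MvPolynomial.X (Sum.inl i, 0)
  let Z : DeltaPoly ι (Fin (1 + 1) ⊕ Fin 1) F := MvPolynomial.X (Sum.inr 0, 0)
  refine ⟨{kolchinForm₁ j (Y 0) (Y 1) Z 1, kolchinForm₂ j (Y 0) (Y 1) Z 1}, ?_, ?_⟩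
  · rintro f (rfl | rfl)
    · exact ⟨4, by simp [DeltaPoly.IsHomogeneousIn, Y, Z, kolchinForm₁_mul_left]⟩
    · exact ⟨3, by simp [DeltaPoly.IsHomogeneousIn, Y, Z, kolchinForm₂_mul_left]⟩
  · ext ⟨p, x⟩
    simp only [Set.mem_ofPred_eq, Set.mem_insert_iff, Set.mem_singleton_iff, forall_eq_or_imp,
      forall_eq, DeltaPoly.eval_kolchinForm₁, DeltaPoly.eval_kolchinForm₂, Y, Z,
      DeltaPoly.eval_X, DeltaPoly.eval_one, deltaOp_zero, Sum.elim_inl, Sum.elim_inr]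
    constructor
    · rintro ⟨y, z, h, hyz⟩
      obtain ⟨rfl, rfl⟩ := Prod.mk.inj h
      obtain ⟨c, hc, h₀, h₁⟩ := exists_rep_affinePoint y
      rw [h₀, h₁]
      simpa using (kolchinForms_eq_zero_iff j hc one_ne_zero y z).2 hyz
    · intro h
      have hp : p.rep 1 ≠ 0 := fun hp => p.rep_nonzero <| funext fun i => by
        rw [hp] at h
        fin_cases i
        · exact eq_zero_of_kolchinForm₁_eq_zero j one_ne_zero h.1
        · exact hp
      refine ⟨p.rep 0 / p.rep 1, x 0, Prod.ext (eq_affinePoint p hp) ?_, ?_⟩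
      · funext i
        fin_cases i
        rfl
      · refine (kolchinForms_eq_zero_iff j hp one_ne_zero _ _).1 ?_
        rwa [mul_div_cancel₀ _ hp, one_mul]

/-- The image of `kolchinSet` in the affine line is the complement of the origin. -/
theorem IsDeltaClosedField.snd_image_kolchinSet (hU : IsDeltaClosedField ι U) (j : ι) :
    Prod.snd '' kolchinSet U j = {x | x 0 ≠ 0} := by
  have := hU.1
  ext x
  constructor
  · rintro ⟨_, ⟨y, z, rfl, hyz⟩, rfl⟩ h
    obtain rfl : z = 0 := h
    exact not_kolchin_zero j y hyz
  · intro hx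
    obtain ⟨y, hy⟩ := hU.exists_kolchin j hx
    refine ⟨(affinePoint y, ![x 0]), ⟨y, x 0, rfl, hy⟩, funext fun i => ?_⟩
    fin_cases i
    rfl

/-- The affine line in `P^1` is quasi-projective. -/
theorem isQuasiProjective_rep_one_ne_zero :
    IsQuasiProjective ι F {p : ℙ U (Fin (1 + 1) → U) | p.rep 1 ≠ 0} := by
  refine ⟨Set.univ, {p | p.rep 1 = 0}, ⟨∅, by simp, by simp⟩,
    ⟨{MvPolynomial.X (1, 0)}, ?_, ?_⟩, ?_⟩
  · rintro f rfl
    exact ⟨1, by simp [DeltaPoly.IsHomogeneousIn]⟩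
  · simp
  · ext p
    simp

/-- Projective space is not `Δ`-complete. The witness is the set of the points
`([y : 1 : 0 : ⋯ : 0], [z : 1])` with `([y : 1], z)` in `kolchinSet`, over the affine line. -/
theorem IsDeltaClosedField.not_isDeltaComplete [DeltaAlgebra ι F U] (hU : IsDeltaClosedField ι U)
    (j : ι) {n : ℕ} (hn : 0 < n) :
    ¬ IsDeltaComplete ι F (Set.univ : Set (ℙ U (Fin (n + 1) → U))) := by
  have := hU.1
  obtain ⟨n, rfl⟩ := Nat.exists_eq_succ_of_ne_zero hn.ne'
  intro hcomplete
  let Y (i : Fin (n + 1 + 1)) : DeltaPoly ι (Fin (n + 1 + 1) ⊕ Fin (1 + 1)) F :=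
    MvPolynomial.X (Sum.inl i, 0)
  let Z (i : Fin (1 + 1)) : DeltaPoly ι (Fin (n + 1 + 1) ⊕ Fin (1 + 1)) F :=
    MvPolynomial.X (Sum.inr i, 0)
  let E : Set (DeltaPoly ι (Fin (n + 1 + 1) ⊕ Fin (1 + 1)) F) :=
    {kolchinForm₁ j (Y 0) (Y 1) (Z 0) (Z 1), kolchinForm₂ j (Y 0) (Y 1) (Z 0) (Z 1)} ∪
      Set.range fun i : Fin n => Y i.succ.succ
  obtain ⟨C, ⟨G, hG, rfl⟩, hC⟩ := hcomplete 1 _ isQuasiProjective_rep_one_ne_zero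
    {p | ∀ f ∈ E, f.eval (Sum.elim p.1.rep p.2.rep) = 0} ⟨E, by
      rintro f ((rfl | rfl) | ⟨i, rfl⟩)
      · exact ⟨⟨4, by simp [DeltaPoly.IsHomogeneousIn, Y, Z, kolchinForm₁_mul_left]⟩,
          1, by simp [DeltaPoly.IsHomogeneousIn, Y, Z, kolchinForm₁_mul_right]⟩
      · exact ⟨⟨3, by simp [DeltaPoly.IsHomogeneousIn, Y, Z, kolchinForm₂_mul_left]⟩,
          2, by simp [DeltaPoly.IsHomogeneousIn, Y, Z, kolchinForm₂_mul_right]⟩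
      · exact ⟨⟨1, by simp [DeltaPoly.IsHomogeneousIn, Y]⟩,
          0, by simp [DeltaPoly.IsHomogeneousIn, Y]⟩, rfl⟩
  have hmem (x : Fin (n + 1 + 1) → U) (z : Fin (1 + 1) → U) :
      (∀ f ∈ E, f.eval (Sum.elim x z) = 0) ↔
        (kolchinForm₁ j (x 0) (x 1) (z 0) (z 1) = 0 ∧
          kolchinForm₂ j (x 0) (x 1) (z 0) (z 1) = 0) ∧ ∀ i : Fin n, x i.succ.succ = 0 := by
    simp [E, Y, Z, or_imp, forall_and]
  -- The origin of the affine line is not in the image.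
  obtain ⟨c, hc, hc₀, hc₁⟩ := exists_rep_affinePoint (0 : U)
  have h₀ : affinePoint (0 : U) ∉ {p : ℙ U (Fin (1 + 1) → U) | ∀ f ∈ G, f.eval p.rep = 0} := by
    intro h
    have h' := hC.ge ⟨h, by simpa [hc₁] using hc⟩
    obtain ⟨⟨q, p⟩, ⟨hq, -⟩, rfl : p = _⟩ := h'
    obtain ⟨hforms, hq₂⟩ := (hmem _ _).1 hq
    rw [hc₀, hc₁] at hforms
    have hq₁ : q.rep 1 ≠ 0 := fun hq₁ => q.rep_nonzero <| funext fun i => by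
      rw [hq₁] at hforms
      refine Fin.cases ?_ (Fin.cases hq₁ hq₂) i
      exact eq_zero_of_kolchinForm₁_eq_zero j hc hforms.1
    rw [← mul_div_cancel₀ (q.rep 0) hq₁] at hforms
    exact not_kolchin_zero j _ ((kolchinForms_eq_zero_iff j hq₁ hc _ _).1 hforms)
  simp only [Set.mem_ofPred_eq, not_forall] at h₀
  obtain ⟨f, hfG, hf⟩ := h₀
  obtain ⟨e, hfe⟩ := hG f hfG
  have hf₀ : f ≠ 0 := by
    rintro rfl
    exact hf (DeltaPoly.eval_zero _)
  obtain ⟨a, ha⟩ := hU.exists_eval_ne_zero (mul_ne_zero (mul_ne_zero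
    (MvPolynomial.X_ne_zero (0, 0)) (MvPolynomial.X_ne_zero (1, 0))) hf₀)
  simp only [DeltaPoly.eval_mul, DeltaPoly.eval_X, deltaOp_zero, mul_ne_zero_iff] at ha
  obtain ⟨⟨ha₀, ha₁⟩, hfa⟩ := ha
  -- The point `[a 0 : a 1]` is in the image, but `f` does not vanish there.
  obtain ⟨d, hd, hd₀, hd₁⟩ := exists_rep_affinePoint (a 0 / a 1)
  obtain ⟨y, hy⟩ := hU.exists_kolchin j (div_ne_zero ha₀ ha₁)
  have hv : (Matrix.vecCons y (Matrix.vecCons 1 0) : Fin (n + 1 + 1) → U) ≠ 0 :=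
    fun h => one_ne_zero (congrFun h 1)
  obtain ⟨t, ht⟩ := Projectivization.exists_smul_eq_mk_rep U _ hv
  have himage : affinePoint (a 0 / a 1) ∈
      {p : ℙ U (Fin (1 + 1) → U) | ∀ f ∈ G, f.eval p.rep = 0} := by
    refine (hC.le ⟨(Projectivization.mk U _ hv, affinePoint (a 0 / a 1)),
      ⟨(hmem _ _).2 ?_, Set.mem_univ _, by simpa [hd₁] using hd⟩, rfl⟩).1
    dsimp only
    rw [← ht, hd₀, hd₁]
    simpa [Units.smul_def] using (kolchinForms_eq_zero_iff j t.ne_zero hd y _).2 hy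
  have hrep : (affinePoint (a 0 / a 1)).rep = fun s => d / a 1 * a s := by
    funext s
    fin_cases s
    · exact hd₀.trans (mul_div_left_comm d (a 0) (a 1) |>.trans (mul_comm _ _))
    · exact hd₁.trans (div_mul_cancel₀ d ha₁).symm
  have hzero := himage f hfG
  rw [hrep, hfe.eval_smul] at hzero
  exact mul_ne_zero (pow_ne_zero _ (div_ne_zero hd ha₁)) hfa hzero

end Projection

theorem proposition2p1 {m : ℕ} (hm : 0 < m) {F : Type u} {U : Type v} [Field F] [Field U]
    [DeltaRing (Fin m) F] [DeltaRing (Fin m) U] [Algebra F U] [DeltaAlgebra (Fin m) F U]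
    (hU : IsDeltaClosedField (Fin m) U) :
    (∀ n : ℕ, 0 < n →
      ¬ IsDeltaComplete (Fin m) F (Set.univ : Set (ℙ U (Fin (n + 1) → U)))) ∧
    ∀ j : Fin m,
      IsDeltaClosedProjAffine (Fin m) F (kolchinSet U j) ∧
      (∀ b : U, IsDeltaTranscendental (Fin m) F b → ![b] ∈ Prod.snd '' kolchinSet U j) ∧
      (IsSaturatedOver (Fin m) F U → ∃ b : U, IsDeltaTranscendental (Fin m) F b) ∧
      ![(0 : U)] ∉ Prod.snd '' kolchinSet U j ∧
      ¬ IsDeltaClosedAffine (Fin m) F (Prod.snd '' kolchinSet U j) := by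
  refine ⟨fun n hn => hU.not_isDeltaComplete ⟨0, hm⟩ hn, fun j => ?_⟩
  rw [hU.snd_image_kolchinSet j]
  refine ⟨isDeltaClosedProjAffine_kolchinSet j, fun b hb => ?_,
    hU.exists_isDeltaTranscendental, by simp, hU.not_isDeltaClosedAffine_ne_zero⟩
  simpa using hb (MvPolynomial.X (0, 0)) (MvPolynomial.X_ne_zero _)
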